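/- Consider the incremental algorithm $G$ that computes the Delaunay triangulation of a sequence of distinct planar points by inserting them one by one, every convex hull edge being joined to a symbolic vertex at infinity by an unbounded triangle (the part of the plane beyond that edge, which plays the role of its circumdisk). The first three points of the sequence, which are not collinear, form the initial triangle. Each further point $p$ is first located: starting at an edge incident to the previously inserted point, $G$ walks from triangle to adjacent triangle, crossing each time an edge that strictly separates the current triangle from $p$, until it reaches the triangle containing $p$; each edge crossed is one navigation operation. More precisely, if the previous search ended in a triangle that it entered across (or, without any crossing, started at) the directed edge $ab$ with that triangle on its left, the next search starts at the edge joining $a$ to the point then inserted (for the initial triangle, $a$ is the first point); and the two other edges of the triangle $abc$ to the left of the current directed edge $ab$ are tested in the order $bc$, $ca$. Then $p$ is joined to the three vertices of that triangle, and edges opposite to $p$ that violate the circumcircle condition, because $p$ lies inside the circumcircle of the triangle across the edge, are flipped until there are none; each flip is one flip operation (hull edges to infinity included). For an integer $k>0$, a sequence is $k$-D-linear if $G$, run on it, performs at most $k$ navigation operations and at most $k$ flips for each point; a $k$-D-linear run of a sequence $S$ is a nonempty $k$-D-linear subsequence of consecutive points of $S$. The greedy partitioning of $S$ with threshold $k$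 runs $G$ on $S$ until the insertion of some point $p$ needs more than $k$ navigation operations or more than $k$ flips, closes the current run just before $p$, and restarts $G$ on the sequence beginning with $p$, until no points are left. An optimal partition of $S$ is a partition of $S$ into the minimum possible number of $k$-D-linear runs. Then for every integer $k>0$ there is a family $(S_n)_{n\ge 0}$, where $S_n$ is a sequence of $n$ distinct planar points without three consecutive collinear points, such that the number of runs yielded by the greedy partitioning of $S_n$ with threshold $k$ is in $\Theta(n)$ as $n\to\infty$ (with constants that may depend on $k$), whereas for all sufficiently large $n$ (depending on $k$) the optimal partition of $S_n$ consists of exactly $2$ $k$-D-linear runs. -/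

import Mathlib

/-! Planar points, the incremental Delaunay algorithm, and partitions into D-linear runs. -/

namespace DLinear

/-- A point of the plane. -/
abbrev Point : Type := ℝ × ℝ

/-- Orientation test: positive iff `a, b, c` is a counterclockwise triangle, that is, iff `c` lies
strictly to the left of the directed line from `a` to `b`; zero iff the points are collinear. -/
def orient (a b c : Point) : ℝ :=
  (b.1 - a.1) * (c.2 - a.2) - (b.2 - a.2) * (c.1 - a.1)

/-- Incircle test: for a counterclockwise triangle `a, b, c`, positive iff `d` lies strictly inside
its circumcircle. -/
def incircle (a b c d : Point) : ℝ :=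
  Matrix.det !![a.1 - d.1, a.2 - d.2, (a.1 - d.1) ^ 2 + (a.2 - d.2) ^ 2;
                b.1 - d.1, b.2 - d.2, (b.1 - d.1) ^ 2 + (b.2 - d.2) ^ 2;
                c.1 - d.1, c.2 - d.2, (c.1 - d.1) ^ 2 + (c.2 - d.2) ^ 2]

/-- A vertex of a triangulation: a point of the plane, or the symbolic vertex `none` at infinity.
Each edge of the convex hull is joined to the vertex at infinity by an unbounded
"ghost" triangle, so that every point of the plane lies in some triangle. -/
abbrev Vertex : Type := Option Point

/-- A triangulation, as an edge-based data structure: `T a b = some c` means that the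
counterclockwise triangle `a, b, c` lies to the left of the directed edge from `a` to `b`;
`T a b = none` means that there is no such directed edge. -/
abbrev Triangulation : Type := Vertex → Vertex → Option Vertex

open Classical in
/-- Set the entry of the directed edge from `a` to `b` to `c`. -/
noncomputable def setApex (T : Triangulation) (a b : Vertex) (c : Option Vertex) :
    Triangulation :=
  fun x y => if x = a ∧ y = b then c else T x y

/-- Add the counterclockwise triangle `a, b, c`. -/
noncomputable def addTriangle (T : Triangulation) (a b c : Vertex) : Triangulation :=
  setApex (setApex (setApex T a b (some c)) b c (some a)) c a (some b)

/-- Remove the edge between `a` and `b`. -/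
noncomputable def removeEdge (T : Triangulation) (a b : Vertex) : Triangulation :=
  setApex (setApex T a b none) b a none

/-- `q` lies beyond the hull edge from `a` to `b`, whose ghost triangle lies to its left: strictly
to the left of the edge, or on the open edge itself. -/
def BeyondEdge (a b q : Point) : Prop :=
  0 < orient a b q ∨
    (orient a b q = 0 ∧ (a.1 - q.1) * (b.1 - q.1) + (a.2 - q.2) * (b.2 - q.2) < 0)

/-- The circumcircle condition of the counterclockwise triangle `a, b, c` is violated by the
point `q`. For a ghost triangle the role of the open circumdisk is played by the region beyond the
hull edge. -/
def InCircumdisk (q : Point) : Vertex → Vertex → Vertex → Prop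
  | some a, some b, some c => 0 < incircle a b c q
  | some a, some b, none => BeyondEdge a b q
  | none, some a, some b => BeyondEdge a b q
  | some b, none, some a => BeyondEdge a b q
  | _, _, _ => False

/-- The triangulation of the three vertices of a counterclockwise triangle `a, b, c`: the triangle
and the ghost triangles of its edges. -/
noncomputable def initialTriangulation (a b c : Point) : Triangulation :=
  addTriangle (addTriangle (addTriangle (addTriangle (fun _ _ => none)
    (some a) (some b) (some c)) (some b) (some a) none) (some c) (some b) none)
    (some a) (some c) none

open Classical in
/-- The side of the edge between `a` and `b` on which the search for `q` starts: the directed edge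
with `q` on its left. If `q` is collinear with the edge, a side with a bounded triangle is taken. -/
noncomputable def startSide (T : Triangulation) (q : Point) (e : Point × Point) : Point × Point :=
  if 0 < orient e.1 e.2 q then e
  else if orient e.1 e.2 q < 0 then (e.2, e.1)
  else if T (some e.1) (some e.2) = some none then (e.2, e.1)
  else e

open Classical in
/-- The location of `q`, with at most `k` navigation operations. The current triangle is the one
to the left of the directed edge `(a, b)`. As long as `q` lies strictly on the wrong side of one of
the other two edges of that triangle, the walk crosses this edge into the adjacent triangle, which
is one navigation operation. The walk ends in the triangle that contains `q`, and returns
a directed edge that has this triangle on its left; a ghost triangle is only ever entered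
across a hull edge beyond which `q` lies, and so it ends the walk. The result is `none` iff more
than `k` navigation operations are needed. -/
noncomputable def locate (T : Triangulation) (q : Point) : ℕ → Point × Point → Option (Point × Point)
  | 0, (a, b) =>
    match T (some a) (some b) with
    | some (some c) => if orient b c q < 0 ∨ orient c a q < 0 then none else some (a, b)
    | _ => some (a, b)
  | k + 1, (a, b) =>
    match T (some a) (some b) with
    | some (some c) =>
      if orient b c q < 0 then locate T q k (c, b)
      else if orient c a q < 0 then locate T q k (a, c)
      else some (a, b)
    | _ => some (a, b)

/-- Flip the edge between `a` and `b`, the common edge of the triangles `p, a, b` and `b, a, d`: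
they are replaced by the triangles `p, a, d` and `p, d, b`. -/
noncomputable def flipEdge (T : Triangulation) (p a b d : Vertex) : Triangulation :=
  addTriangle (addTriangle (removeEdge T a b) p a d) p d b

open Classical in
/-- The correction of the triangulation after the insertion of `p`, with at most `k` flips. The list
holds the edges `(a, b)` that remain to be examined, each of them the edge opposite to `p` in
a triangle `p, a, b`. If the triangle `b, a, d` on the other side of the edge has `p` inside its
circumcircle, then the edge is flipped, which is one flip operation, and the edges `(a, d)` and
`(d, b)` have to be examined in turn. The result is `none` iff more than `k` flips are needed. -/
noncomputable def correct (p : Point) : ℕ → List (Vertex × Vertex) → Triangulation →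
    Option Triangulation
  | _, [], T => some T
  | k, (a, b) :: rest, T =>
    match T b a with
    | none => correct p k rest T
    | some d =>
      if InCircumdisk p b a d then
        match k with
        | 0 => none
        | k' + 1 => correct p k' ((a, d) :: (d, b) :: rest) (flipEdge T (some p) a b d)
      else correct p k rest T
  termination_by k l => (k, l.length)

/-- Subdivide the triangle `a, b, c` that contains `p` by three new edges from `p`. -/
noncomputable def subdivide (T : Triangulation) (p a b c : Vertex) : Triangulation :=
  addTriangle (addTriangle (addTriangle T p a b) p b c) p c a

/-- The state of the incremental algorithm: no point, one point or two points so far; or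
a triangulation, with the edge at which the next search starts. -/
inductive GState : Type
  | zero : GState
  | one (a : Point) : GState
  | two (a b : Point) : GState
  | tri (T : Triangulation) (e : Point × Point) : GState

open Classical in
/-- The insertion of the point `p` by the incremental algorithm, with at most `k` navigation
operations to locate `p` and at most `k` flips; the result is `none` iff one of these two bounds is
exceeded. The first three points form the initial triangle (the algorithm is not started on three
collinear points); the next search starts at an edge incident to the point inserted last. -/
noncomputable def insertPoint (k : ℕ) : GState → Point → Option GState
  | .zero, p => some (.one p)
  | .one a, p => some (.two a p)
  | .two a b, p =>
    if 0 < orient a b p then some (.tri (initialTriangulation a b p) (a, p))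
    else if orient a b p < 0 then some (.tri (initialTriangulation b a p) (a, p))
    else none
  | .tri T e, p =>
    match locate T p k (startSide T p e) with
    | none => none
    | some (a, b) =>
      match T (some a) (some b) with
      | none => none
      | some c =>
        match correct p k [(some a, some b), (some b, c), (c, some a)]
            (subdivide T (some p) (some a) (some b) c) with
        | none => none
        | some T' => some (.tri T' (a, p))

/-- The sequence `S` is `k`-D-linear: for each point, the incremental algorithm run on `S` performs
at most `k` navigation operations and at most `k` flips. -/
def IsDLinear (k : ℕ) (S : List Point) : Prop :=
  (S.foldlM (insertPoint k) GState.zero).isSome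

/-- The greedy partitioning, when the incremental algorithm is in the state `s` and the current run
is `run`: points are added to the current run as long as the bound `k` on the operations is
not exceeded; the point at which it is exceeded is the first point of the next run, on which the
algorithm is restarted. -/
noncomputable def greedyFrom (k : ℕ) (s : GState) (run : List Point) :
    List Point → List (List Point)
  | [] => [run]
  | p :: rest =>
    match insertPoint k s p with
    | some s' => greedyFrom k s' (run ++ [p]) rest
    | none => run :: greedyFrom k (GState.one p) [p] rest

/-- The list of runs produced by the greedy partitioning of a sequence with threshold `k`. -/
noncomputable def greedyPartition (k : ℕ) : List Point → List (List Point)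
  | [] => []
  | p :: rest => greedyFrom k (GState.one p) [p] rest

/-- `L` is a partition of the sequence `S` into `k`-D-linear runs of consecutive points. -/
def IsRunPartition (k : ℕ) (S : List Point) (L : List (List Point)) : Prop :=
  L.flatten = S ∧ ∀ R ∈ L, R ≠ [] ∧ IsDLinear k R

/-- The number of runs in an optimal partition of `S` into `k`-D-linear runs is `m`. -/
def IsOptimalRunCount (k : ℕ) (S : List Point) (m : ℕ) : Prop :=
  IsLeast {r : ℕ | ∃ L : List (List Point), IsRunPartition k S L ∧ L.length = r} m

/-- No three consecutive points of the sequence are collinear. -/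
def NoConsecutiveCollinear (S : List Point) : Prop :=
  ∀ a b c : Point, [a, b, c] <:+: S → orient a b c ≠ 0

end DLinear

namespace DLinear

/-! ### Points of the parabola `y = -x²` -/

/-! All points lie on the parabola `y = -x²` with positive abscissas. There the incircle determinant
is a Vandermonde product times the sum of the four abscissas (`incircle_pt`), so both geometric
tests depend only on the order of the abscissas. The points are in convex position, and their
Delaunay triangulation is the fan centred at the point of least abscissa.

Insertion by decreasing abscissa moves the centre every time: every diagonal must be flipped, `l -
1` of them when the old fan has centre `q l` (`IsFan.insertPoint`). So a decreasing run stops after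
`k + 3` points. If the least point comes first, it stays the centre: the following decreasing points
cost no flip and no navigation (`IsShielded.insertPoint`).

The sequence is decreasing except for one low point, at index `k + 2`. Greedy spends this point as
the last one of its first run; the next point lies between the last two abscissas and needs a walk
through the whole fan, `k + 1` crossings (`IsFan.locate_eq_none`). All later greedy runs are
decreasing and have at most `k + 3` points, hence linearly many runs. Cutting just before the low
point instead lets it shield the entire tail, so two runs suffice; one does not, because greedy
already fails on the whole sequence. -/

/-- The point with abscissa `x` of the parabola `y = -x²`. -/
def pt (x : ℝ) : Point := (x, -x ^ 2)

theorem pt_injective : Function.Injective pt := fun _ _ h => congrArg Prod.fst h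

theorem orient_pt (x y z : ℝ) :
    orient (pt x) (pt y) (pt z) = (y - x) * (z - x) * (y - z) := by
  simp only [orient, pt]; ring

/-- A circle meets the parabola in points whose abscissas sum to zero, whence the last factor. It is
positive for positive abscissas, which leaves the sign to the order alone. -/
theorem incircle_pt (x y z w : ℝ) :
    incircle (pt x) (pt y) (pt z) (pt w) =
      (x - y) * (x - z) * (y - z) * (x - w) * (y - w) * (z - w) * (x + y + z + w) := by
  simp only [incircle, pt, Matrix.det_fin_three, Matrix.of_apply, Matrix.cons_val', Matrix.cons_val,
    Matrix.cons_val_zero, Matrix.cons_val_one, Matrix.cons_val_fin_one]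
  ring

theorem orient_pt_pos {x y z : ℝ} (hxy : y < x) (hyz : z < y) :
    0 < orient (pt x) (pt y) (pt z) := by
  rw [orient_pt]
  exact mul_pos (mul_pos_of_neg_of_neg (by linarith) (by linarith)) (by linarith)

theorem orient_rotate (a b c : Point) : orient b c a = orient a b c := by
  simp only [orient]; ring

theorem orient_swap (a b c : Point) : orient b a c = -orient a b c := by
  simp only [orient]; ring

theorem orient_pt_ne_zero {x y z : ℝ} (hxy : x ≠ y) (hxz : x ≠ z) (hyz : y ≠ z) :
    orient (pt x) (pt y) (pt z) ≠ 0 := by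
  rw [orient_pt]
  exact mul_ne_zero (mul_ne_zero (sub_ne_zero.2 hxy.symm) (sub_ne_zero.2 hxz.symm))
    (sub_ne_zero.2 hyz)

theorem not_beyondEdge {a b q : Point} (h : 0 < orient b a q) : ¬ BeyondEdge a b q := by
  rw [orient_swap] at h
  rintro (h' | ⟨h', -⟩) <;> linarith

/-! ### One step of the correction -/

theorem correct_nil (p : Point) (k : ℕ) (T : Triangulation) : correct p k [] T = some T := by
  rw [correct]

theorem correct_cons_of_not {p : Point} {k : ℕ} {a b d : Vertex} {l : List (Vertex × Vertex)}
    {T : Triangulation} (hT : T b a = some d) (h : ¬ InCircumdisk p b a d) :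
    correct p k ((a, b) :: l) T = correct p k l T := by
  rw [correct]; simp [hT, h]

theorem correct_zero_cons {p : Point} {a b d : Vertex} {l : List (Vertex × Vertex)}
    {T : Triangulation} (hT : T b a = some d) (h : InCircumdisk p b a d) :
    correct p 0 ((a, b) :: l) T = none := by
  rw [correct]; simp [hT, h]

theorem correct_succ_cons {p : Point} {k : ℕ} {a b d : Vertex} {l : List (Vertex × Vertex)}
    {T : Triangulation} (hT : T b a = some d) (h : InCircumdisk p b a d) :
    correct p (k + 1) ((a, b) :: l) T =
      correct p k ((a, d) :: (d, b) :: l) (flipEdge T (some p) a b d) := by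
  rw [correct]; simp [hT, h]

/-! ### Points inserted by decreasing abscissa -/

/-- The vertex with abscissa `x` on the parabola. -/
def vx (x : ℝ) : Vertex := some (pt x)

theorem vx_inj {x y : ℝ} : vx x = vx y ↔ x = y := by
  simp [vx, pt_injective.eq_iff]

@[simp]
theorem vx_ne_none (x : ℝ) : vx x ≠ none := by simp [vx]

@[simp]
theorem none_ne_vx (x : ℝ) : none ≠ vx x := by simp [vx]

/-- `T` contains the triangles of the fan with centre `q l` over the points `q 0, …, q (l - 1)`,
and the ghost triangles around it. -/
structure IsFan (T : Triangulation) (q : ℕ → ℝ) (l : ℕ) : Prop where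
  fan : ∀ i, i + 1 < l → T (vx (q l)) (vx (q i)) = some (vx (q (i + 1)))
  hull : ∀ i, i < l → T (vx (q (i + 1))) (vx (q i)) = some none
  close : T (vx (q 0)) (vx (q l)) = some none
  ghost_last : T none (vx (q l)) = some (vx (q (l - 1)))
  ghost_first : T (vx (q 0)) none = some (vx (q 1))

/-- The state of the correction after the insertion of `q (l + 1)` into the fan with centre `q l`,
when the edges from `q l` to `q 0, …, q (i - 1)` have been flipped. -/
structure IsPartialFan (T : Triangulation) (q : ℕ → ℝ) (l i : ℕ) : Prop where
  old : ∀ j, i ≤ j → j + 1 < l → T (vx (q l)) (vx (q j)) = some (vx (q (j + 1)))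
  new : ∀ j, j < i → T (vx (q (l + 1))) (vx (q j)) = some (vx (q (j + 1)))
  front : T (vx (q (l + 1))) (vx (q i)) = some (vx (q l))
  hull : ∀ i, i < l + 1 → T (vx (q (i + 1))) (vx (q i)) = some none
  close : T (vx (q 0)) (vx (q (l + 1))) = some none
  ghost_last : T none (vx (q (l + 1))) = some (vx (q l))
  ghost_old : T none (vx (q l)) = some (vx (q (l - 1)))
  ghost_first : T (vx (q 0)) none = some (vx (q 1))

variable {q : ℕ → ℝ}

theorem IsPartialFan.isFan {T : Triangulation} {l : ℕ} (hl : 1 ≤ l)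
    (h : IsPartialFan T q l (l - 1)) : IsFan T q (l + 1) where
  fan i hi := by
    rcases Nat.lt_or_ge i (l - 1) with h' | h'
    · exact h.new i h'
    · obtain rfl : i = l - 1 := by omega
      rw [h.front]; congr; omega
  hull := h.hull
  close := h.close
  ghost_last := h.ghost_last
  ghost_first := h.ghost_first

/-- The new point lies beyond the hull edge between `q 0` and `q l`, so the triangle being
subdivided is a ghost and the fan itself is still intact. -/
theorem IsFan.subdivide (hq : StrictAnti q) {T : Triangulation} {l : ℕ} (hl : 2 ≤ l)
    (h : IsFan T q l) :
    IsPartialFan (subdivide T (vx (q (l + 1))) (vx (q 0)) (vx (q l)) none) q l 0 := by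
  -- Vertex equality becomes index equality, so each table lookup is settled by arithmetic on
  -- indices.
  have key : ∀ i j, vx (q i) = vx (q j) ↔ i = j := fun i j => by
    rw [vx_inj, hq.injective.eq_iff]
  constructor
  · intro j _ hj
    have h' := h.fan j hj
    simp [DLinear.subdivide, addTriangle, setApex, key, h']
    grind
  · intro j hj; omega
  · simp [DLinear.subdivide, addTriangle, setApex, key]
    grind
  · intro i hi
    rcases Nat.lt_succ_iff_lt_or_eq.1 hi with hi | rfl
    · have h' := h.hull i hi
      simp [DLinear.subdivide, addTriangle, setApex, key, h']
      grind
    · simp [DLinear.subdivide, addTriangle, setApex, key]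
  · simp [DLinear.subdivide, addTriangle, setApex]
  · simp [DLinear.subdivide, addTriangle, setApex, key]
  · simp [DLinear.subdivide, addTriangle, setApex, key, h.ghost_last]
    grind
  · simp [DLinear.subdivide, addTriangle, setApex, key, h.ghost_first]
    grind

theorem IsPartialFan.flipEdge (hq : StrictAnti q) {T : Triangulation} {l i : ℕ} (hi : i + 1 < l)
    (h : IsPartialFan T q l i) :
    IsPartialFan (flipEdge T (vx (q (l + 1))) (vx (q i)) (vx (q l)) (vx (q (i + 1)))) q l (i + 1) := by
  have key : ∀ i j, vx (q i) = vx (q j) ↔ i = j := fun i j => by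
    rw [vx_inj, hq.injective.eq_iff]
  constructor
  · intro j hj hjl
    have h' := h.old j (by omega) hjl
    simp [DLinear.flipEdge, removeEdge, addTriangle, setApex, key, h']
    grind
  · intro j hj
    rcases Nat.lt_succ_iff_lt_or_eq.1 hj with hj | rfl
    · have h' := h.new j hj
      simp [DLinear.flipEdge, removeEdge, addTriangle, setApex, key, h']
      grind
    · simp [DLinear.flipEdge, addTriangle, setApex, key]
      grind
  · simp [DLinear.flipEdge, addTriangle, setApex, key]
    grind
  · intro j hj
    have h' := h.hull j hj
    simp [DLinear.flipEdge, removeEdge, addTriangle, setApex, key, h']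
    grind
  · have h' := h.close
    simp [DLinear.flipEdge, removeEdge, addTriangle, setApex, key, h']
    grind
  · simp [DLinear.flipEdge, removeEdge, addTriangle, setApex, key, h.ghost_last]
  · simp [DLinear.flipEdge, removeEdge, addTriangle, setApex, key, h.ghost_old]
  · simp [DLinear.flipEdge, removeEdge, addTriangle, setApex, key, h.ghost_first]

/-- Here `n` is the number of diagonals at the old centre `q l` that are still to be flipped. Each
of them violates the circumcircle condition, so the budget suffices exactly when `n ≤ k`. -/
theorem IsPartialFan.correct (hq : StrictAnti q) (hpos : ∀ i, 0 < q i) {l : ℕ} (n : ℕ) :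
    ∀ {i k : ℕ} {T : Triangulation}, i + n + 1 = l → IsPartialFan T q l i →
      (n ≤ k → ∃ T', IsFan T' q (l + 1) ∧
        correct (pt (q (l + 1))) k
          [(vx (q i), vx (q l)), (vx (q l), none), (none, vx (q 0))] T = some T') ∧
      (k < n → correct (pt (q (l + 1))) k
          [(vx (q i), vx (q l)), (vx (q l), none), (none, vx (q 0))] T = none) := by
  induction n with
  | zero =>
    rintro i k T rfl h
    refine ⟨fun _ => ⟨T, h.isFan (by omega), ?_⟩, fun h' => absurd h' (by omega)⟩
    -- The three edges left have only ghost triangles across them, and the new point is beyond none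
    -- of the corresponding hull edges.
    rw [correct_cons_of_not (h.hull i (by omega)), correct_cons_of_not h.ghost_old,
      correct_cons_of_not h.ghost_first, correct_nil]
    · refine not_beyondEdge ?_
      exact orient_pt_pos (hq (by omega)) (hq (by omega))
    · refine not_beyondEdge ?_
      exact orient_pt_pos (hq (by omega)) (hq (by omega))
    · refine not_beyondEdge ?_
      exact orient_pt_pos (hq (by omega)) (hq (by omega))
  | succ n ih =>
    intro i k T hl h
    have hflip : InCircumdisk (pt (q (l + 1))) (vx (q l)) (vx (q i)) (vx (q (i + 1))) := by
      change 0 < incircle _ _ _ _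
      rw [incircle_pt]
      have h1 : q l < q i := hq (by omega)
      have h2 : q l < q (i + 1) := hq (by omega)
      have h3 : q (i + 1) < q i := hq (by omega)
      have h4 : q (l + 1) < q l := hq (by omega)
      have := hpos l; have := hpos i; have := hpos (i + 1); have := hpos (l + 1)
      -- The only two negative factors of the determinant are paired here.
      have e1 : 0 < (q l - q i) * (q l - q (i + 1)) :=
        mul_pos_of_neg_of_neg (by linarith) (by linarith)
      have e2 : 0 < q i - q (i + 1) := by linarith
      have e3 : 0 < q l - q (l + 1) := by linarith
      have e4 : 0 < q i - q (l + 1) := by linarith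
      have e5 : 0 < q (i + 1) - q (l + 1) := by linarith
      positivity
    cases k with
    | zero =>
      refine ⟨fun h' => absurd h' (by omega), fun _ => ?_⟩
      rw [correct_zero_cons (h.old i le_rfl (by omega)) hflip]
    | succ k =>
      rw [correct_succ_cons (h.old i le_rfl (by omega)) hflip]
      have h' := h.flipEdge hq (by omega)
      -- Of the two edges put on the list by the flip, the first is a hull edge and stays; the
      -- second is the next diagonal.
      rw [show (some (pt (q (l + 1))) : Vertex) = vx (q (l + 1)) from rfl,
        correct_cons_of_not (h'.hull i (by omega))]
      · have := ih (i := i + 1) (k := k) (by omega) h'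
        exact ⟨fun hk => this.1 (by omega), fun hk => this.2 (by omega)⟩
      · refine not_beyondEdge ?_
        exact orient_pt_pos (hq (by omega)) (hq (by omega))

theorem locate_ghost {T : Triangulation} {p a b : Point} (h : T (some a) (some b) = some none)
    (k : ℕ) : locate T p k (a, b) = some (a, b) := by
  cases k <;> simp [locate, h]

/-- Inserting the next point by decreasing abscissa into a fan over `l` points takes
`l - 1` flips. -/
theorem IsFan.insertPoint (hq : StrictAnti q) (hpos : ∀ i, 0 < q i) {l : ℕ} (hl : 2 ≤ l)
    {T : Triangulation} (h : IsFan T q l) (k : ℕ) :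
    (l ≤ k + 1 → ∃ T', IsFan T' q (l + 1) ∧
      insertPoint k (.tri T (pt (q 0), pt (q l))) (pt (q (l + 1))) =
        some (.tri T' (pt (q 0), pt (q (l + 1))))) ∧
    (k + 1 < l → insertPoint k (.tri T (pt (q 0), pt (q l))) (pt (q (l + 1))) = none) := by
  have hside : startSide T (pt (q (l + 1))) (pt (q 0), pt (q l)) = (pt (q 0), pt (q l)) := by
    rw [startSide, if_pos]
    exact orient_pt_pos (hq (by omega)) (hq (by omega))
  have hc : T (some (pt (q 0))) (some (pt (q l))) = some none := h.close
  have key := IsPartialFan.correct hq hpos (l - 1) (i := 0) (k := k) (by omega)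
    (h.subdivide hq hl)
  simp only [vx] at key
  constructor
  · intro hk
    obtain ⟨T', hT', e⟩ := key.1 (by omega)
    exact ⟨T', hT', by simp [DLinear.insertPoint, hside, locate_ghost hc, hc, e]⟩
  · intro hk
    have e := key.2 (by omega)
    simp [DLinear.insertPoint, hside, locate_ghost hc, hc, e]

/-- The target lies beyond the last hull edge, from `q (l - 1)` to `q l`, so it is separated from
each fan triangle by the side that leads to the next one. From the edge to `q i` this makes `l - 1 -
i` crossings, including the one into the ghost triangle. -/
theorem IsFan.locate_eq_none (hq : StrictAnti q) {T : Triangulation} {l : ℕ} (h : IsFan T q l)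
    {x : ℝ} (h₁ : q l < x) (h₂ : x < q (l - 1)) (k : ℕ) :
    ∀ i, k + i + 1 < l → locate T (pt x) k (pt (q l), pt (q i)) = none := by
  have aux : ∀ i, i + 1 < l → T (some (pt (q l))) (some (pt (q i))) = some (some (pt (q (i + 1)))) ∧
      ¬ orient (pt (q i)) (pt (q (i + 1))) (pt x) < 0 ∧
      orient (pt (q (i + 1))) (pt (q l)) (pt x) < 0 := by
    intro i hi
    have hx : x < q (i + 1) := h₂.trans_le (hq.antitone (by omega))
    have := orient_pt_pos hx h₁
    refine ⟨h.fan i hi, (orient_pt_pos (hq (by omega)) hx).not_gt, ?_⟩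
    simp only [orient] at this ⊢
    linarith
  induction k with
  | zero =>
    intro i hi
    obtain ⟨h1, -, h3⟩ := aux i (by omega)
    simp [locate, h1, h3]
  | succ k ih =>
    intro i hi
    obtain ⟨h1, h2, h3⟩ := aux i (by omega)
    simp only [locate, h1, h2, h3, if_true, if_false]
    exact ih _ (by omega)

/-- A point between the last two points of a decreasing sequence is located from the first one by
crossing all edges of the fan. -/
theorem IsFan.insertPoint_eq_none (hq : StrictAnti q) {T : Triangulation} {l k : ℕ}
    (h : IsFan T q l) {x : ℝ} (h₁ : q l < x) (h₂ : x < q (l - 1)) (hk : k + 1 < l) :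
    DLinear.insertPoint k (.tri T (pt (q 0), pt (q l))) (pt x) = none := by
  have ho : orient (pt (q 0)) (pt (q l)) (pt x) < 0 := by
    have := orient_pt_pos (h₂.trans_le (hq.antitone (Nat.zero_le (l - 1)))) h₁
    simp only [orient] at *
    linarith
  have hside : startSide T (pt x) (pt (q 0), pt (q l)) = (pt (q l), pt (q 0)) := by
    rw [startSide, if_neg ho.not_gt, if_pos ho]
  simp [DLinear.insertPoint, hside, h.locate_eq_none hq h₁ h₂ k 0 (by omega)]

theorem isFan_initialTriangulation (hq : StrictAnti q) :
    IsFan (initialTriangulation (pt (q 0)) (pt (q 1)) (pt (q 2))) q 2 := by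
  have key : ∀ i j, vx (q i) = vx (q j) ↔ i = j := fun i j => by
    rw [vx_inj, hq.injective.eq_iff]
  have hv : ∀ i, some (pt (q i)) = vx (q i) := fun i => rfl
  constructor
  · intro i hi
    obtain rfl : i = 0 := by omega
    simp [initialTriangulation, addTriangle, setApex, hv, key]
  · intro i hi
    interval_cases i <;> simp [initialTriangulation, addTriangle, setApex, hv, key]
  all_goals simp [initialTriangulation, addTriangle, setApex, hv, key]

/-- A sequence of at most `k + 3` points by decreasing abscissa is inserted within the bounds. -/
theorem foldlM_decreasing (hq : StrictAnti q) (hpos : ∀ i, 0 < q i) {k l : ℕ} (hl : 2 ≤ l)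
    (hk : l ≤ k + 2) :
    ∃ T, IsFan T q l ∧ ((List.range (l + 1)).map fun i => pt (q i)).foldlM (insertPoint k) .zero =
      some (.tri T (pt (q 0), pt (q l))) := by
  induction l, hl using Nat.le_induction with
  | base =>
    refine ⟨_, isFan_initialTriangulation hq, ?_⟩
    have := orient_pt_pos (hq zero_lt_one) (hq one_lt_two)
    simp [List.range_succ, insertPoint, this]
  | succ l hl ih =>
    obtain ⟨T, hT, e⟩ := ih (by omega)
    obtain ⟨T', hT', e'⟩ := (hT.insertPoint hq hpos hl k).1 (by omega)
    refine ⟨T', hT', ?_⟩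
    rw [List.range_succ, List.map_append, List.foldlM_append, e]
    simp [e']

/-! ### A first point that shields the following ones -/

/-- `T` contains the triangle at the hull edge from `q n` to `a`, and the ghost triangles
around it. -/
structure IsShielded (T : Triangulation) (a : ℝ) (q : ℕ → ℝ) (n : ℕ) : Prop where
  last : T (vx (q (n + 1))) (vx a) = some (vx (q n))
  close : T (vx a) (vx (q (n + 1))) = some none
  ghost_last : T none (vx (q (n + 1))) = some (vx (q n))
  ghost_first : T (vx a) none = some (vx (q 0))

/-- With `a` the least abscissa, the fan centred at `a` is already Delaunay: the new point is found
at once in the ghost triangle of the starting edge, and joining it merely extends the fan. -/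
theorem IsShielded.insertPoint (hq : StrictAnti q) {a : ℝ} (ha : 0 < a) (haq : ∀ i, a < q i)
    {T : Triangulation} {n : ℕ} (h : IsShielded T a q n) (k : ℕ) :
    ∃ T', IsShielded T' a q (n + 1) ∧
      insertPoint k (.tri T (pt a, pt (q (n + 1)))) (pt (q (n + 2))) =
        some (.tri T' (pt a, pt (q (n + 2)))) := by
  have key : ∀ i j, vx (q i) = vx (q j) ↔ i = j := fun i j => by
    rw [vx_inj, hq.injective.eq_iff]
  have key₁ : ∀ i, vx (q i) ≠ vx a := fun i => by rw [Ne, vx_inj]; exact (haq i).ne'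
  have key₂ : ∀ i, vx a ≠ vx (q i) := fun i => (key₁ i).symm
  set T' := subdivide T (vx (q (n + 2))) (vx a) (vx (q (n + 1))) none with hT'
  have hlast : T' (vx (q (n + 1))) (vx a) = some (vx (q n)) := by
    simp [hT', subdivide, addTriangle, setApex, key, key₁, key₂, h.last]
  have hgl : T' none (vx (q (n + 1))) = some (vx (q n)) := by
    simp [hT', subdivide, addTriangle, setApex, key, key₁, h.ghost_last]
  have hgf : T' (vx a) none = some (vx (q 0)) := by
    simp [hT', subdivide, addTriangle, setApex, key₂, h.ghost_first]
  refine ⟨T', ⟨?_, ?_, ?_, hgf⟩, ?_⟩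
  · simp [hT', subdivide, addTriangle, setApex, key₂]
  · simp [hT', subdivide, addTriangle, setApex]
  · simp [hT', subdivide, addTriangle, setApex, key₁]
  have hside : startSide T (pt (q (n + 2))) (pt a, pt (q (n + 1))) = (pt a, pt (q (n + 1))) := by
    rw [startSide, if_pos]
    rw [← orient_rotate]
    exact orient_pt_pos (hq (by omega)) (haq _)
  have hc : T (some (pt a)) (some (pt (q (n + 1)))) = some none := h.close
  have hcorr : correct (pt (q (n + 2))) k
      [(vx a, vx (q (n + 1))), (vx (q (n + 1)), none), (none, vx a)] T' = some T' := by
    rw [correct_cons_of_not hlast, correct_cons_of_not hgl, correct_cons_of_not hgf, correct_nil]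
    · refine not_beyondEdge ?_
      rw [← orient_rotate]
      exact orient_pt_pos (hq (by omega)) (haq _)
    · refine not_beyondEdge ?_
      exact orient_pt_pos (hq (by omega)) (hq (by omega))
    -- Three factors are negative here, so the sign is opposite to that of the decreasing case.
    · change ¬ 0 < incircle _ _ _ _
      rw [incircle_pt, not_lt]
      have h1 := haq n
      have h2 := haq (n + 1)
      have h3 := haq (n + 2)
      have h4 : q (n + 1) < q n := hq (by omega)
      have h5 : q (n + 2) < q (n + 1) := hq (by omega)
      have e1 : 0 < q (n + 1) - a := by linarith
      have e2 : q (n + 1) - q n < 0 := by linarith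
      have e3 : a - q n < 0 := by linarith
      have e4 : 0 < q (n + 1) - q (n + 2) := by linarith
      have e5 : a - q (n + 2) < 0 := by linarith
      have e6 : 0 < q n - q (n + 2) := by linarith
      have e7 : 0 < q (n + 1) + a + q n + q (n + 2) := by linarith
      exact (mul_neg_of_neg_of_pos (mul_neg_of_neg_of_pos (mul_neg_of_pos_of_neg (mul_pos
        (mul_pos_of_neg_of_neg (mul_neg_of_pos_of_neg e1 e2) e3) e4) e5) e6) e7).le
  have hcorr' := hcorr
  simp only [hT', vx] at hcorr'
  simp only [DLinear.insertPoint, hside, locate_ghost hc, hc, hcorr']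
  rfl

theorem foldlM_shielded (hq : StrictAnti q) {a : ℝ} (ha : 0 < a) (haq : ∀ i, a < q i) (k n : ℕ) :
    ∃ T, IsShielded T a q n ∧
      (pt a :: (List.range (n + 2)).map fun i => pt (q i)).foldlM (insertPoint k) .zero =
        some (.tri T (pt a, pt (q (n + 1)))) := by
  induction n with
  | zero =>
    have key : ∀ i j, vx (q i) = vx (q j) ↔ i = j := fun i j => by
      rw [vx_inj, hq.injective.eq_iff]
    have key₁ : ∀ i, vx (q i) ≠ vx a := fun i => by rw [Ne, vx_inj]; exact (haq i).ne'
    have key₂ : ∀ i, vx a ≠ vx (q i) := fun i => (key₁ i).symm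
    have hv : ∀ x, some (pt x) = vx x := fun x => rfl
    have ho : 0 < orient (pt a) (pt (q 0)) (pt (q 1)) := by
      rw [← orient_rotate]
      exact orient_pt_pos (hq zero_lt_one) (haq 1)
    refine ⟨initialTriangulation (pt a) (pt (q 0)) (pt (q 1)), ?_, ?_⟩
    · constructor <;> simp [initialTriangulation, addTriangle, setApex, hv, key, key₁, key₂]
    · simp [List.range_succ, insertPoint, ho]
  | succ n ih =>
    obtain ⟨T, hT, e⟩ := ih
    obtain ⟨T', hT', e'⟩ := hT.insertPoint hq ha haq k
    refine ⟨T', hT', ?_⟩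
    rw [List.range_succ, List.map_append, ← List.cons_append, List.foldlM_append, e]
    simp [e']

/-! ### Runs of the greedy partitioning -/

theorem length_greedyFrom_le (k : ℕ) (l : List Point) : ∀ (s : GState) (run : List Point),
    (greedyFrom k s run l).length ≤ l.length + 1 := by
  induction l with
  | nil => intro s run; simp [greedyFrom]
  | cons p l ih =>
    intro s run
    rw [greedyFrom]
    split
    · exact (ih _ _).trans (by simp)
    · simpa using ih (.one p) [p]

theorem length_greedyPartition_le (k : ℕ) (l : List Point) :
    (greedyPartition k l).length ≤ l.length := by
  cases l with
  | nil => simp [greedyPartition]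
  | cons p l => simpa [greedyPartition] using length_greedyFrom_le k l (.one p) [p]

theorem greedyFrom_ne_nil (k : ℕ) (l : List Point) : ∀ (s : GState) (run : List Point),
    greedyFrom k s run l ≠ [] := by
  induction l with
  | nil => intro s run; simp [greedyFrom]
  | cons p l ih =>
    intro s run
    rw [greedyFrom]
    split
    · exact ih _ _
    · simp

theorem greedyFrom_append {k : ℕ} (rest : List Point) (l : List Point) :
    ∀ {s s' : GState} (run : List Point), l.foldlM (insertPoint k) s = some s' →
      greedyFrom k s run (l ++ rest) = greedyFrom k s' (run ++ l) rest := by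
  induction l with
  | nil => intro s s' run h; simp at h; simp [h]
  | cons p l ih =>
    intro s s' run h
    rw [List.foldlM_cons] at h
    obtain ⟨t, ht, h⟩ := Option.bind_eq_some_iff.1 h
    rw [List.cons_append, greedyFrom, ht]
    simpa using ih (run ++ [p]) h

/-- The greedy partitioning closes the run before the first point that exceeds the bounds. -/
theorem greedyPartition_append_cons {k : ℕ} {l rest : List Point} {p : Point} {s : GState}
    (hl : l ≠ []) (h : l.foldlM (insertPoint k) .zero = some s) (hp : insertPoint k s p = none) :
    greedyPartition k (l ++ p :: rest) = l :: greedyPartition k (p :: rest) := by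
  obtain ⟨a, l, rfl⟩ := List.exists_cons_of_ne_nil hl
  rw [List.foldlM_cons] at h
  rw [List.cons_append, greedyPartition, greedyFrom_append _ _ _ (show _ = some s from h)]
  simp [greedyFrom, hp, greedyPartition]

theorem not_isDLinear_append_cons {k : ℕ} {l rest : List Point} {p : Point} {s : GState}
    (h : l.foldlM (insertPoint k) .zero = some s) (hp : insertPoint k s p = none) :
    ¬ IsDLinear k (l ++ p :: rest) := by
  simp [IsDLinear, List.foldlM_append, h, hp]

theorem isOptimalRunCount_two {k : ℕ} {l₁ l₂ : List Point} (h₁ : l₁ ≠ []) (h₂ : l₂ ≠ [])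
    (hd₁ : IsDLinear k l₁) (hd₂ : IsDLinear k l₂) (hd : ¬ IsDLinear k (l₁ ++ l₂)) :
    IsOptimalRunCount k (l₁ ++ l₂) 2 := by
  refine ⟨⟨[l₁, l₂], ⟨by simp, by simp [h₁, h₂, hd₁, hd₂]⟩, rfl⟩, ?_⟩
  rintro r ⟨L, ⟨hL, hR⟩, rfl⟩
  match L with
  | [] => simp [h₁] at hL
  | [R] =>
    have := (hR R (by simp)).2
    simp at hL
    exact absurd (hL ▸ this) hd
  | _ :: _ :: L => simp

/-! ### The sequence -/

/-- Abscissas of the sequence: decreasing, except that the point of index `k + 2` lies below all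
others. -/
noncomputable def absc (k j : ℕ) : ℝ := 1 / ((j : ℝ) + 1) + if j = k + 2 then 1 else 2

theorem one_div_strictAnti (c : ℝ) (s : ℕ) :
    StrictAnti fun j : ℕ => 1 / (((s + j : ℕ) : ℝ) + 1) + c := by
  intro i j hij
  have : (i : ℝ) < j := by exact_mod_cast hij
  have : 1 / (((s + j : ℕ) : ℝ) + 1) < 1 / (((s + i : ℕ) : ℝ) + 1) :=
    one_div_lt_one_div_of_lt (by positivity) (by push_cast; linarith)
  simpa using this

theorem absc_pos (k j : ℕ) : 0 < absc k j := by
  unfold absc; split_ifs <;> positivity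

theorem absc_low_lt (k j : ℕ) (hj : j ≠ k + 2) : absc k (k + 2) < absc k j := by
  -- The low abscissa is at most 2, all others exceed 2.
  have h1 : 1 / (((k + 2 : ℕ) : ℝ) + 1) ≤ 1 := by
    rw [div_le_one (by positivity)]; linarith [Nat.cast_nonneg (α := ℝ) (k + 2)]
  have h2 : 0 < 1 / ((j : ℝ) + 1) := by positivity
  simp only [absc, if_true, if_neg hj]
  linarith

theorem absc_lt {k i j : ℕ} (hij : i < j) (hi : i ≠ k + 2) : absc k j < absc k i := by
  by_cases hj : j = k + 2
  · subst hj; exact absc_low_lt k i hi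
  · have := one_div_strictAnti 2 0 hij
    simpa [absc, hi, hj] using this

theorem absc_injective (k : ℕ) : Function.Injective (absc k) := by
  intro i j h
  by_contra hne
  wlog hij : i < j generalizing i j
  · exact this h.symm (Ne.symm hne) (by omega)
  by_cases hi : i = k + 2
  · subst hi
    exact (absc_low_lt k j (Ne.symm hne)).ne h
  · exact (absc_lt hij hi).ne' h

theorem absc_strictAnti_tail {k s : ℕ} (hs : k + 3 ≤ s) :
    StrictAnti fun j => absc k (s + j) := fun _ _ hij =>
  absc_lt (by omega) (by omega)

/-- A decreasing sequence that agrees with `absc k` up to the index `k + 2`. -/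
noncomputable def head (k j : ℕ) : ℝ := 1 / ((j : ℝ) + 1) + if j < k + 2 then 2 else 1

theorem head_strictAnti (k : ℕ) : StrictAnti (head k) := by
  intro i j hij
  have := one_div_strictAnti 0 0 hij
  simp only [zero_add, add_zero] at this
  unfold head
  split_ifs <;> first | omega | linarith

theorem head_pos (k j : ℕ) : 0 < head k j := by
  unfold head; split_ifs <;> positivity

theorem head_eq_absc {k j : ℕ} (hj : j < k + 3) : head k j = absc k j := by
  unfold head absc
  rcases Nat.lt_succ_iff_lt_or_eq.1 hj with h | rfl
  · simp [h, h.ne]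
  · simp

/-- The points of index `s, …, s + n - 1`. -/
noncomputable def window (k s n : ℕ) : List Point := (List.range n).map fun j => pt (absc k (s + j))

theorem window_add (k s m n : ℕ) : window k s (m + n) = window k s m ++ window k (s + m) n := by
  simp [window, List.range_add, add_assoc]

theorem window_succ (k s n : ℕ) : window k s (n + 1) = pt (absc k s) :: window k (s + 1) n := by
  rw [add_comm n, window_add]; simp [window]

theorem length_window (k s n : ℕ) : (window k s n).length = n := by simp [window]

theorem window_zero_eq_head {k n : ℕ} (hn : n ≤ k + 3) :
    window k 0 n = (List.range n).map fun j => pt (head k j) := by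
  refine List.map_congr_left fun j hj => ?_
  rw [head_eq_absc ((List.mem_range.1 hj).trans_le hn), zero_add]

/-- From the start, and from every point after the low one, the algorithm inserts `k + 3` points
within the bounds, and then exceeds them. -/
theorem exists_state_window {k s : ℕ} (hk : 0 < k) (hs : s = 0 ∨ k + 3 ≤ s) :
    ∃ t, (window k s (k + 3)).foldlM (insertPoint k) .zero = some t ∧
      insertPoint k t (pt (absc k (s + (k + 3)))) = none := by
  rcases hs with rfl | hs
  -- The initial part is treated through `head`, which is decreasing on all of `ℕ`. Its last
  -- insertion uses exactly `k` flips; the next point then fails by navigation.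
  · obtain ⟨T, hT, e⟩ := foldlM_decreasing (head_strictAnti k) (head_pos k) (k := k) (l := k + 2)
      (by omega) le_rfl
    refine ⟨_, (window_zero_eq_head le_rfl ▸ e :), ?_⟩
    refine hT.insertPoint_eq_none (head_strictAnti k) ?_ ?_ (by omega)
    · rw [head_eq_absc (by omega)]
      exact absc_low_lt k _ (by omega)
    · rw [head_eq_absc (by omega)]
      exact absc_lt (by omega) (by omega)
  -- Past the low point the next insertion continues the decrease and fails by needing `k + 1`
  -- flips.
  · have hq := absc_strictAnti_tail hs
    have hpos : ∀ j, 0 < absc k (s + j) := fun j => absc_pos k _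
    obtain ⟨T, hT, e⟩ := foldlM_decreasing hq hpos (k := k) (l := k + 2) (by omega) le_rfl
    exact ⟨_, e, (hT.insertPoint hq hpos (by omega) k).2 (by omega)⟩

/-- The condition on `s` holds at every start of a greedy run: each full run has `k + 3` points, so
the first restart falls just after the low point. -/
theorem le_length_greedyPartition_window {k : ℕ} (hk : 0 < k) (n : ℕ) :
    ∀ s, s = 0 ∨ k + 3 ≤ s → n ≤ (k + 3) * (greedyPartition k (window k s n)).length := by
  induction n using Nat.strong_induction_on with
  | _ n ih =>
    intro s hs
    rcases Nat.eq_zero_or_pos n with rfl | hn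
    · simp
    rcases Nat.lt_or_ge (k + 3) n with h | h
    · obtain ⟨m, rfl⟩ := Nat.exists_eq_add_of_lt h
      obtain ⟨t, ht, hp⟩ := exists_state_window hk hs
      have := ih (m + 1) (by omega) (s + (k + 3)) (by omega)
      rw [add_assoc (k + 3), window_add, window_succ k (s + (k + 3)),
        greedyPartition_append_cons _ ht hp,
        ← window_succ, List.length_cons]
      · linarith
      · rw [← List.length_pos_iff_ne_nil, length_window]; omega
    · obtain ⟨m, rfl⟩ := Nat.exists_eq_succ_of_ne_zero hn.ne'
      have : 0 < (greedyPartition k (window k s (m + 1))).length := by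
        rw [List.length_pos_iff_ne_nil, window_succ, greedyPartition]
        exact greedyFrom_ne_nil _ _ _ _
      exact h.trans (Nat.le_mul_of_pos_right _ this)

theorem isDLinear_head {k : ℕ} (hk : 0 < k) : IsDLinear k (window k 0 (k + 2)) := by
  obtain ⟨T, -, e⟩ := foldlM_decreasing (head_strictAnti k) (head_pos k) (k := k) (l := k + 1)
    (by omega) (by omega)
  rw [IsDLinear, window_zero_eq_head (by omega), e]
  rfl

/-- This run opens with the low point, which shields all the points after it; hence there is no
bound on its length. -/
theorem isDLinear_tail (k n : ℕ) : IsDLinear k (window k (k + 2) (n + 3)) := by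
  obtain ⟨T, -, e⟩ := foldlM_shielded (absc_strictAnti_tail (k := k) le_rfl) (absc_pos k (k + 2))
    (fun j => absc_low_lt k _ (by omega)) k n
  rw [IsDLinear, window_succ]
  exact Option.isSome_of_eq_some e

theorem nodup_window (k s n : ℕ) : (window k s n).Nodup :=
  List.nodup_range.map fun i j h => by
    have := absc_injective k (pt_injective h)
    omega

theorem noConsecutiveCollinear_window (k s n : ℕ) : NoConsecutiveCollinear (window k s n) := by
  intro a b c h
  have hpt : ∀ p ∈ [a, b, c], ∃ x, pt x = p := fun p hp => by
    obtain ⟨j, -, hj⟩ := List.mem_map.1 (h.subset hp)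
    exact ⟨_, hj⟩
  obtain ⟨x, rfl⟩ := hpt a (by simp)
  obtain ⟨y, rfl⟩ := hpt b (by simp)
  obtain ⟨z, rfl⟩ := hpt c (by simp)
  have := (nodup_window k s n).sublist h.sublist
  simp only [List.nodup_cons, List.mem_cons, List.not_mem_nil, or_false, not_or,
    pt_injective.eq_iff] at this
  exact orient_pt_ne_zero this.1.1 this.1.2 this.2.1

end DLinear

open DLinear in
theorem mainTheorem5 (k : ℕ) (hk : 0 < k) :
    ∃ S : ℕ → List Point,
      (∀ n, (S n).length = n ∧ (S n).Nodup ∧ NoConsecutiveCollinear (S n)) ∧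
      (fun n => ((greedyPartition k (S n)).length : ℝ)) =Θ[Filter.atTop] (fun n => (n : ℝ)) ∧
      ∀ᶠ n in Filter.atTop, IsOptimalRunCount k (S n) 2 := by
  refine ⟨window k 0, fun n => ⟨length_window k 0 n, nodup_window k 0 n,
    noConsecutiveCollinear_window k 0 n⟩, ⟨?_, ?_⟩, ?_⟩
  · refine Asymptotics.IsBigO.of_bound 1 (.of_forall fun n => ?_)
    have := length_greedyPartition_le k (window k 0 n)
    rw [length_window] at this
    simpa using this
  · refine Asymptotics.IsBigO.of_bound ((k + 3 : ℕ) : ℝ) (.of_forall fun n => ?_)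
    have := le_length_greedyPartition_window hk n 0 (.inl rfl)
    rw [Real.norm_natCast, Real.norm_natCast]
    exact_mod_cast this
  -- The bound is `k + 2` points before the low one, plus the three points that `isDLinear_tail`
  -- requires.
  · filter_upwards [Filter.eventually_ge_atTop (k + 5)] with n hn
    obtain ⟨m, rfl⟩ := Nat.exists_eq_add_of_le hn
    obtain ⟨t, ht, hp⟩ := exists_state_window (s := 0) hk (.inl rfl)
    -- The failure at index `k + 3`, which ends the first greedy run, also rules out a single run.
    have hd := not_isDLinear_append_cons (rest := window k (0 + (k + 3) + 1) (m + 1)) ht hp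
    rw [← window_succ, ← window_add,
      show k + 3 + (m + 1 + 1) = (k + 2) + (m + 3) by omega, window_add, zero_add] at hd
    rw [show k + 5 + m = (k + 2) + (m + 3) by omega, window_add, zero_add]
    refine isOptimalRunCount_two ?_ ?_ (isDLinear_head hk) (isDLinear_tail k m) hd <;>
    · rw [← List.length_pos_iff_ne_nil, length_window]; omega
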